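/- **Theorem 4.4.** Let $P$ be a finite poset. Write $\mathrm{LE}(Q)$ for the number of linear extensions of a poset $Q$, that is, of total orders on the elements of $Q$ that contain its partial order; in particular $\mathrm{LE}(\emptyset)=1$. The incomparability graph $\mathrm{IG}_P$ has the elements of $P$ as vertices, and an edge between any two incomparable elements. A module of a graph is a non-empty set of vertices all of which have the same neighbours outside the set, and a modular partition is a partition of the vertex set into modules. Let $D\ge 0$ and let $M_1,\dots,M_{2D+1}$ be subsets of $P$ such that $M_s$ is non-empty for odd $s$ (the sets $M_s$ with $s$ even may be empty), and such that the non-empty ones among them, indexed without repetition, form a modular partition of $\mathrm{IG}_P$. Let the skeleton be the graph on the indices $1,\dots,2D+1$ in which $s\ne t$ are joined if some element of $M_s$ is incomparable to some element of $M_t$. Suppose that - for $1\le k\le D$ there is an edge between $2k-1$ and $2k+1$; - for $1\le k\le D$ with $M_{2k}\neq\emptyset$ there is an edge between $2k-1$ and $2k$; - for $1\le k\le D$ there may or may not be an edge between $2k$ and $2k+1$; - there are no other edges. Put $m_s=|M_s|$, and give each $M_s$ the order induced from $P$. Then $$\mathrm{LE}(P)=\prod_{s=1}^{2D+1}\mathrm{LE}(M_s)\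 \sum_{(i_1,i_3,\dots,i_{2D-1})}\ \prod_{d=1}^{D}\binom{m_{2d}+m_{2d-1}+i_{2d+1}-i_{2d-1}-1}{m_{2d-1}-i_{2d-1}}\,\Phi_{2d},$$ where the sum runs over all tuples of integers with $0\le i_{2d-1}\le m_{2d-1}$ for $1\le d\le D$, where $i_{2D+1}=m_{2D+1}$, and where $$\Phi_{2d}=\begin{cases}\binom{m_{2d}+i_{2d+1}}{m_{2d}} & \text{if } M_{2d}\ne\emptyset \text{ and every element of } M_{2d} \text{ is incomparable to every element of } M_{2d+1},\\ 1 & \text{otherwise,}\end{cases}$$ with the conventions $\binom{-1}{0}=1$ and $\binom{n-1}{n}=0$ for $n>0$. (For $D=0$ the sum has the single, empty tuple, and equals $1$.) -/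

import Mathlib

/-- The number `LE(P)` of linear extensions of a poset: total orders `r` on its elements that
contain the partial order. -/
noncomputable def numLinearExtensions (P : Type*) [PartialOrder P] : ℕ :=
  Nat.card {r : P → P → Prop // IsLinearOrder P r ∧ ∀ x y, x ≤ y → r x y}

/-- The incomparability graph of a poset. -/
def incomparabilityGraph (P : Type*) [PartialOrder P] : SimpleGraph P where
  Adj x y := IncompRel (· ≤ ·) x y
  symm := ⟨fun _ _ h => ⟨h.2, h.1⟩⟩
  loopless := ⟨fun x h => h.1 (le_refl x)⟩

/-- A module of a graph: a non-empty set of vertices all of which have the same neighbours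
outside the set. -/
def IsGraphModule {V : Type*} (G : SimpleGraph V) (A : Set V) : Prop :=
  A.Nonempty ∧ ∀ x ∈ A, ∀ y ∈ A, ∀ z, z ∉ A → (G.Adj x z ↔ G.Adj y z)

/-- The sets `M s`, for `s` in the index set `I`, form a modular partition of the graph `G`
(indices outside `I` play no role). -/
structure IsModularPartition {V ι : Type*} (G : SimpleGraph V) (I : Set ι) (M : ι → Set V) :
    Prop where
  isModule : ∀ s ∈ I, IsGraphModule G (M s)
  disjoint : ∀ s ∈ I, ∀ t ∈ I, s ≠ t → Disjoint (M s) (M t)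
  cover : ∀ x : V, ∃ s ∈ I, x ∈ M s

/-- The skeleton of a family of vertex sets: two distinct indices are joined if some edge of `G`
joins the corresponding sets. -/
def skeletonGraph {V ι : Type*} (G : SimpleGraph V) (M : ι → Set V) : SimpleGraph ι where
  Adj s t := s ≠ t ∧ ∃ x ∈ M s, ∃ y ∈ M t, G.Adj x y
  symm := ⟨fun _ _ ⟨hne, x, hx, y, hy, hxy⟩ => ⟨hne.symm, y, hy, x, hx, hxy.symm⟩⟩
  loopless := ⟨fun _ h => h.1 rfl⟩

/-- The indices, among `1, …, 2D+1`, of the modules that exist: all odd indices, and the even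
indices whose set is non-empty. -/
def moduleIndices {V : Type*} (D : ℕ) (M : ℕ → Set V) : Set ℕ :=
  {s | 1 ≤ s ∧ s ≤ 2 * D + 1 ∧ (Odd s ∨ (M s).Nonempty)}

/-- The conditions on the skeleton graph `S` of `M 1, …, M (2D+1)`. An edge between `2k` and
`2k+1` is allowed but not required. -/
structure IsJoinedSkeleton {V : Type*} (D : ℕ) (M : ℕ → Set V) (S : SimpleGraph ℕ) : Prop where
  odd_odd : ∀ k, 1 ≤ k → k ≤ D → S.Adj (2 * k - 1) (2 * k + 1)
  odd_even : ∀ k, 1 ≤ k → k ≤ D → (M (2 * k)).Nonempty → S.Adj (2 * k - 1) (2 * k)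
  no_other : ∀ s t, 1 ≤ s → s < t → t ≤ 2 * D + 1 → S.Adj s t →
    ∃ k, 1 ≤ k ∧ k ≤ D ∧
      ((s = 2 * k - 1 ∧ t = 2 * k + 1) ∨ (s = 2 * k - 1 ∧ t = 2 * k) ∨
        (s = 2 * k ∧ t = 2 * k + 1))

/-- The tuples `(i₁, i₃, …, i_{2D+1})` of possible pivots; the entry at position `k` is
`i_{2k+1}`. One has `0 ≤ i_{2k+1} ≤ m_{2k+1}` for `k < D`, and `i_{2D+1} = m_{2D+1}`. -/
def pivotTuples (D : ℕ) (m : ℕ → ℕ) : Finset (Fin (D + 1) → ℕ) :=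
  Fintype.piFinset fun k =>
    if (k : ℕ) = D then {m (2 * D + 1)} else Finset.range (m (2 * (k : ℕ) + 1) + 1)

open Classical in
/-- The factor attached to the module `A = M_{2d}` and its successor `B = M_{2d+1}`, with
`j = i_{2d+1}`. -/
noncomputable def pivotFactor {P : Type*} [PartialOrder P] (A B : Set P) (j : ℕ) : ℕ :=
  if A.Nonempty ∧ ∀ x ∈ A, ∀ y ∈ B, IncompRel (· ≤ ·) x y then
    (A.ncard + j).choose A.ncard
  else 1

/-- The summand of a pivot tuple `i`. The factor of index `d : Fin D` is the one of number
`d + 1`, so that `2 * d + 2`, `2 * d + 1`, `i d.succ` and `i d.castSucc` are the `2d`, `2d - 1`,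
`i_{2d+1}` and `i_{2d-1}` of the formula. The top entry of the binomial coefficient is
`m_{2d} + i_{2d+1} + (m_{2d-1} - i_{2d-1}) - 1`, so the subtraction `- 1` in `ℕ` is truncated only
if all three terms vanish; the value is then `0.choose 0 = 1`, which agrees with the convention
`(-1).choose 0 = 1`. -/
noncomputable def pivotTerm {P : Type*} [PartialOrder P] (D : ℕ) (M : ℕ → Set P)
    (i : Fin (D + 1) → ℕ) : ℕ :=
  ∏ d : Fin D,
    ((M (2 * (d : ℕ) + 2)).ncard + (M (2 * (d : ℕ) + 1)).ncard + i d.succ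
        - i d.castSucc - 1).choose ((M (2 * (d : ℕ) + 1)).ncard - i d.castSucc) *
      pivotFactor (M (2 * (d : ℕ) + 2)) (M (2 * (d : ℕ) + 3)) (i d.succ)

/-!
# Linear extensions of posets whose incomparability graph has a path-like skeleton

The elements of different modules are either all incomparable or all comparable, but the order
between two comparable modules is not determined by the skeleton: elements of one module can lie
on both sides of an element of another one. So linear extensions are not enumerated directly.
Instead, both sides of the formula are shown to satisfy a recurrence that only refers to
comparability.

Let `e S` be the number of linear extensions of a finite subset `S`. If `A` is an antichain of `S`
that meets every maximal chain of `S`, then `e S = ∑ a ∈ A, e (S \ {a})`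
(`IsCut.numLE_eq_sum`, due to Edelman, Hibi and Stanley). For the set of maximal elements this is
the classification of linear extensions by their top element
(`numLE_eq_sum_maxElements`); the general case follows by induction on the size of `S`.

Now let `S` be a set whose parts in the modules have sizes `m s`. When the last two parts,
`2d` and `2d + 1`, are not both empty, a suitable antichain consists of the maximal elements of the
parts `2d - 1`, `2d`, `2d + 1` if the last two are joined, and of the maximal elements of the part
`2d - 1` and of one non-empty part out of the last two if they are not. No other part is joined to
the last two, and so these antichains meet every maximal chain
(`isCut_biUnion_maxElements`). Removing a maximal element of a part lowers one size `m s` by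
one and, summed over the maximal elements of the part, leaves the factor `e` of the part unchanged.
The formula thus reduces to a recurrence for the sum over pivots in terms of the sizes; this is
Pascal's rule for its binomial coefficients (`shuffleCount_of_joined`,
`shuffleCount_of_not_joined`). When the last two parts are empty, the sum over the last pivot
collapses to one term and `D` drops by one (`shuffleCount_drop`). Since elements are removed one
by one, the formula is proved for all subsets of the poset at once, including those that
miss some of the odd modules (`numLE_eq_prod_mul_shuffleCount`).
-/

/-! ### Linear extensions and maximal elements -/

theorem numLinearExtensions_congr {α β : Type*} [PartialOrder α] [PartialOrder β] (e : α ≃o β) :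
    numLinearExtensions α = numLinearExtensions β := by
  refine Nat.card_congr (Equiv.subtypeEquiv (Equiv.arrowCongr e.toEquiv
    (Equiv.arrowCongr e.toEquiv (Equiv.refl Prop))) fun r => ?_)
  have key : ∀ (a b : β), (Equiv.arrowCongr e.toEquiv
      (Equiv.arrowCongr e.toEquiv (Equiv.refl Prop))) r a b = r (e.symm a) (e.symm b) :=
    fun _ _ => rfl
  constructor
  · rintro ⟨h, h'⟩
    refine ⟨{ refl := fun a => ?_, trans := fun a b c => ?_, antisymm := fun a b => ?_,
              total := fun a b => ?_ }, fun a b hab => ?_⟩ <;> simp only [key]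
    · exact h.refl _
    · exact h.trans _ _ _
    · exact fun h1 h2 => e.symm.injective (h.antisymm _ _ h1 h2)
    · exact h.total _ _
    · exact h' _ _ (e.symm.monotone hab)
  · rintro ⟨h, h'⟩
    have key' : ∀ a b, r a b = (Equiv.arrowCongr e.toEquiv
      (Equiv.arrowCongr e.toEquiv (Equiv.refl Prop))) r (e a) (e b) := by
      intro a b; rw [key]; simp
    refine ⟨{ refl := fun a => ?_, trans := fun a b c => ?_, antisymm := fun a b => ?_,
              total := fun a b => ?_ }, fun a b hab => ?_⟩ <;> simp only [key']
    · exact h.refl _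
    · exact h.trans _ _ _
    · exact fun h1 h2 => e.injective (h.antisymm _ _ h1 h2)
    · exact h.total _ _
    · exact h' _ _ (e.monotone hab)

theorem numLinearExtensions_of_isEmpty (α : Type*) [PartialOrder α] [IsEmpty α] :
    numLinearExtensions α = 1 := by
  refine Nat.card_eq_one_iff_unique.2 ⟨⟨fun r s => Subtype.ext ?_⟩, ⟨⟨fun _ _ => True, ?_, ?_⟩⟩⟩
  · funext x
    exact isEmptyElim x
  · refine { refl := ?_, trans := ?_, antisymm := ?_, total := ?_ } <;> exact isEmptyElim
  · exact isEmptyElim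

/-- The relation on `α` that puts `x` on top of a relation `r` on the other elements. -/
def addTop {α : Type*} (x : α) (r : {y // y ≠ x} → {y // y ≠ x} → Prop) (a b : α) : Prop :=
  b = x ∨ ∃ (ha : a ≠ x) (hb : b ≠ x), r ⟨a, ha⟩ ⟨b, hb⟩

theorem addTop_coe {α : Type*} (x : α) (r : {y // y ≠ x} → {y // y ≠ x} → Prop)
    (a b : {y // y ≠ x}) : addTop x r a b ↔ r a b :=
  ⟨fun h => h.elim (fun h => absurd h b.2) fun ⟨_, _, h⟩ => h, fun h => .inr ⟨a.2, b.2, h⟩⟩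

theorem isLinearOrder_addTop {α : Type*} (x : α) (r : {y // y ≠ x} → {y // y ≠ x} → Prop)
    (h : IsLinearOrder _ r) : IsLinearOrder α (addTop x r) where
  refl a := by
    by_cases ha : a = x
    · exact .inl ha
    · exact .inr ⟨ha, ha, h.refl _⟩
  trans a b c := by
    rintro (rfl | ⟨ha, hb, h1⟩) (rfl | ⟨hb', hc, h2⟩)
    · exact .inl rfl
    · exact absurd rfl hb'
    · exact .inl rfl
    · exact .inr ⟨ha, hc, h.trans _ _ _ h1 h2⟩
  antisymm a b := by
    rintro (rfl | ⟨ha, hb, h1⟩) (rfl | ⟨hb', ha', h2⟩)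
    · rfl
    · exact absurd rfl hb'
    · exact absurd rfl ha
    · exact congrArg Subtype.val (h.antisymm _ _ h1 h2)
  total a b := by
    by_cases ha : a = x
    · exact .inr (.inl ha)
    by_cases hb : b = x
    · exact .inl (.inl hb)
    exact (h.total ⟨a, ha⟩ ⟨b, hb⟩).imp (fun h => .inr ⟨ha, hb, h⟩) fun h => .inr ⟨hb, ha, h⟩

/-- The top element of a linear extension is a maximal element of the poset, and removing it leaves
an arbitrary linear extension of the remaining poset. -/
theorem numLinearExtensions_eq_sum_isMax (α : Type*) [Fintype α] [Nonempty α] [PartialOrder α]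
    [Fintype {x : α // IsMax x}] :
    numLinearExtensions α = ∑ x : {x : α // IsMax x}, numLinearExtensions {y // y ≠ x.1} := by
  classical
  unfold numLinearExtensions
  rw [← Nat.card_sigma]
  symm
  refine Nat.card_eq_of_bijective (fun p => ⟨addTop p.1.1 p.2.1, ?_, ?_⟩) ⟨?_, ?_⟩
  · exact isLinearOrder_addTop _ _ p.2.2.1
  · intro a b hab
    by_cases hb : b = p.1.1
    · exact .inl hb
    · have ha : a ≠ p.1.1 := by
        rintro rfl
        exact hb (le_antisymm (p.1.2 hab) hab)
      exact .inr ⟨ha, hb, p.2.2.2 _ _ hab⟩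
  · rintro ⟨⟨x, hx⟩, r, hr⟩ ⟨⟨y, hy⟩, s, hs⟩ h
    have h' : addTop x r = addTop y s := congrArg Subtype.val h
    have hxy : x = y := by
      refine (isLinearOrder_addTop x r hr.1).antisymm x y ?_ (.inl rfl)
      rw [h']
      exact .inl rfl
    subst hxy
    have : r = s := by
      funext a b
      rw [← propext (addTop_coe x r a b), h', propext (addTop_coe x s a b)]
    subst this
    rfl
  · rintro ⟨r, hr, hle⟩
    have := hr.toIsPreorder.toIsTrans
    obtain ⟨x, hx⟩ : ∃ x, ∀ y, r y x := by
      have hd : Directed r (id : α → α) := fun a b =>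
        (hr.total a b).elim (fun h => ⟨b, h, hr.refl b⟩) fun h => ⟨a, hr.refl a, h⟩
      obtain ⟨x, hx⟩ := hd.finite_le id
      exact ⟨x, hx⟩
    have hmax : IsMax x := fun y hy => (hr.antisymm _ _ (hle _ _ hy) (hx y)).ge
    refine ⟨⟨⟨x, hmax⟩, fun a b => r a b, ?_, fun a b hab => hle _ _ hab⟩, Subtype.ext ?_⟩
    · exact { refl := fun a => hr.refl _, trans := fun a b c => hr.trans _ _ _
              antisymm := fun a b h1 h2 => Subtype.ext (hr.antisymm _ _ h1 h2)
              total := fun a b => hr.total _ _ }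
    · funext a b
      refine propext ⟨?_, fun h => ?_⟩
      · rintro (rfl | ⟨_, _, h⟩)
        · exact hx a
        · exact h
      · by_cases hb : b = x
        · exact .inl hb
        · refine .inr ⟨?_, hb, h⟩
          rintro rfl
          exact hb (hr.antisymm _ _ (hx b) h)

section Finset
variable {P : Type*} [PartialOrder P]

/-- The number of linear extensions of the subposet of `P` carried by a finite set `S`. -/
noncomputable def numLE (S : Finset P) : ℕ := numLinearExtensions S

open Classical in
/-- The maximal elements of a finite set in a poset. -/
noncomputable def maxElements (S : Finset P) : Finset P := {x ∈ S | ∀ y ∈ S, ¬ x < y}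

theorem mem_maxElements {S : Finset P} {x : P} :
    x ∈ maxElements S ↔ x ∈ S ∧ ∀ y ∈ S, ¬ x < y := by
  simp [maxElements]

theorem maxElements_subset (S : Finset P) : maxElements S ⊆ S :=
  fun _ hx => (mem_maxElements.1 hx).1

theorem exists_le_maxElements {S : Finset P} {x : P} (hx : x ∈ S) :
    ∃ y ∈ maxElements S, x ≤ y := by
  obtain ⟨y, hxy, hy⟩ := S.exists_le_maximal hx
  exact ⟨y, mem_maxElements.2 ⟨hy.1, fun z hz => hy.not_gt hz⟩, hxy⟩

theorem numLE_empty : numLE (∅ : Finset P) = 1 :=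
  numLinearExtensions_of_isEmpty _

theorem numLE_eq_sum_maxElements [DecidableEq P] {S : Finset P} (hS : S.Nonempty) :
    numLE S = ∑ x ∈ maxElements S, numLE (S.erase x) := by
  classical
  have := hS.to_subtype
  have h1 : ∀ x : S, IsMax x ↔ x.1 ∈ maxElements S := by
    intro x
    rw [mem_maxElements, isMax_iff_forall_not_lt]
    exact ⟨fun h => ⟨x.2, fun y hy hxy => h ⟨y, hy⟩ hxy⟩, fun h y hy => h.2 y y.2 hy⟩
  rw [numLE, numLinearExtensions_eq_sum_isMax]
  refine Finset.sum_bij (fun x _ => x.1.1) (fun x _ => (h1 _).1 x.2)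
    (fun x _ y _ h => Subtype.ext (Subtype.ext h))
    (fun x hx => ⟨⟨⟨x, maxElements_subset _ hx⟩, (h1 _).2 hx⟩, Finset.mem_univ _, rfl⟩) ?_
  intro x _
  refine numLinearExtensions_congr ⟨⟨fun y => ⟨y.1.1, Finset.mem_erase.2
    ⟨fun h => y.2 (Subtype.ext h), y.1.2⟩⟩, fun y => ⟨⟨y.1, Finset.mem_of_mem_erase y.2⟩,
    fun h => Finset.ne_of_mem_erase y.2 (congrArg Subtype.val h)⟩, fun _ => rfl, fun _ => rfl⟩,
    Iff.rfl⟩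

end Finset

/-! ### The recurrence along an antichain that meets every maximal chain -/

section Cut
variable {P : Type*} [PartialOrder P]

/-- `A` is an antichain in `S` that meets every maximal chain of `S`. The second condition is
expressed by saying that every chain of `S` stays a chain after a suitable element of `A` is
added. -/
structure IsCut (S A : Finset P) : Prop where
  subset : A ⊆ S
  antichain : ∀ a ∈ A, ∀ b ∈ A, a ≤ b → a = b
  extend : ∀ C : Finset P, C ⊆ S → IsChain (· ≤ ·) (C : Set P) →
    ∃ a ∈ A, ∀ c ∈ C, a ≤ c ∨ c ≤ a

theorem exists_maxElements_of_isChain {S C : Finset P} (hS : S.Nonempty) (hCS : C ⊆ S)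
    (hC : IsChain (· ≤ ·) (C : Set P)) : ∃ m ∈ maxElements S, ∀ c ∈ C, c ≤ m := by
  rcases C.eq_empty_or_nonempty with rfl | hne
  · obtain ⟨x, hx⟩ := hS
    obtain ⟨m, hm, -⟩ := exists_le_maxElements hx
    exact ⟨m, hm, by simp⟩
  · obtain ⟨t, ht⟩ := C.exists_maximal hne
    obtain ⟨m, hm, htm⟩ := exists_le_maxElements (hCS ht.1)
    refine ⟨m, hm, fun c hc => le_trans ?_ htm⟩
    exact (hC.total hc ht.1).elim id fun h => ht.2 hc h

variable [DecidableEq P]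

theorem IsCut.erase {S A : Finset P} (h : IsCut S A) {x : P} (hx : x ∉ A) :
    IsCut (S.erase x) A where
  subset _ ha := Finset.mem_erase.2 ⟨fun e => hx (e ▸ ha), h.subset ha⟩
  antichain := h.antichain
  extend C hC := h.extend C (hC.trans (Finset.erase_subset _ _))

/-- If a maximal element `x` of `S` in the cut `A` is removed from `S`, then a cut of the remaining
set is obtained by replacing `x` in `A` by the maximal elements that its removal creates. -/
theorem IsCut.erase_union {S A : Finset P} (h : IsCut S A) {x : P} (hxA : x ∈ A)
    (hx : x ∈ maxElements S) (hne : (S.erase x).Nonempty) :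
    IsCut (S.erase x) (A.erase x ∪ (maxElements (S.erase x) \ maxElements S)) := by
  have hlt : ∀ n ∈ maxElements (S.erase x) \ maxElements S, n < x := by
    intro n hn
    obtain ⟨h1, h2⟩ := Finset.mem_sdiff.1 hn
    obtain ⟨h3, h4⟩ := mem_maxElements.1 h1
    by_contra hnx
    refine h2 (mem_maxElements.2 ⟨Finset.mem_of_mem_erase h3, fun y hy hny => ?_⟩)
    by_cases hyx : y = x
    · exact hnx (hyx ▸ hny)
    · exact h4 y (Finset.mem_erase.2 ⟨hyx, hy⟩) hny
  constructor
  · exact Finset.union_subset (Finset.erase_subset_erase _ h.subset)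
      (Finset.sdiff_subset.trans (maxElements_subset _))
  · intro a ha b hb hab
    rcases Finset.mem_union.1 ha with ha | ha <;> rcases Finset.mem_union.1 hb with hb | hb
    · exact h.antichain a (Finset.mem_of_mem_erase ha) b (Finset.mem_of_mem_erase hb) hab
    · exact absurd (h.antichain a (Finset.mem_of_mem_erase ha) x hxA (hab.trans (hlt b hb).le))
        (Finset.ne_of_mem_erase ha)
    · by_contra hne
      exact (mem_maxElements.1 (Finset.mem_sdiff.1 ha).1).2 b
        (Finset.erase_subset_erase _ h.subset hb) (lt_of_le_of_ne hab hne)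
    · by_contra hne
      exact (mem_maxElements.1 (Finset.mem_sdiff.1 ha).1).2 b
        (maxElements_subset _ (Finset.mem_sdiff.1 hb).1) (lt_of_le_of_ne hab hne)
  · intro C hC hchain
    obtain ⟨m, hm, hCm⟩ := exists_maxElements_of_isChain hne hC hchain
    by_cases hmX : m ∈ maxElements S
    · -- `x` is incomparable to the other maximal element `m`, so `m` forces the choice of an
      -- element of `A` other than `x`
      have hmx := Finset.mem_erase.1 (maxElements_subset _ hm)
      obtain ⟨a, ha, hac⟩ := h.extend (insert m C)
        (Finset.insert_subset hmx.2 (hC.trans (Finset.erase_subset _ _)))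
        (by rw [Finset.coe_insert]
            exact hchain.insert fun c hc _ => Or.inr (hCm c hc))
      refine ⟨a, Finset.mem_union_left _ (Finset.mem_erase.2 ⟨?_, ha⟩),
        fun c hc => hac c (Finset.mem_insert_of_mem hc)⟩
      rintro rfl
      rcases hac m (Finset.mem_insert_self _ _) with h1 | h1
      · exact (mem_maxElements.1 hx).2 m hmx.2 (lt_of_le_of_ne h1 hmx.1.symm)
      · exact (mem_maxElements.1 hmX).2 _ (maxElements_subset _ hx) (lt_of_le_of_ne h1 hmx.1)
    · exact ⟨m, Finset.mem_union_right _ (Finset.mem_sdiff.2 ⟨hm, hmX⟩),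
        fun c hc => Or.inr (hCm c hc)⟩

theorem maxElements_erase_of_notMem {S : Finset P} {a : P} (haS : a ∈ S)
    (ha : a ∉ maxElements S) : maxElements (S.erase a) = maxElements S := by
  obtain ⟨m, hm, ham⟩ := exists_le_maxElements haS
  have hlt : a < m := lt_of_le_of_ne ham fun e => ha (e ▸ hm)
  ext y
  simp only [mem_maxElements, Finset.mem_erase]
  constructor
  · rintro ⟨⟨hya, hy⟩, h⟩
    refine ⟨hy, fun z hz hyz => ?_⟩
    by_cases hza : z = a
    · exact h m ⟨hlt.ne', maxElements_subset _ hm⟩ (hyz.trans (hza ▸ hlt))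
    · exact h z ⟨hza, hz⟩ hyz
  · rintro ⟨hy, h⟩
    refine ⟨⟨?_, hy⟩, fun z hz => h z hz.2⟩
    rintro rfl
    exact h m (maxElements_subset _ hm) hlt

theorem maxElements_erase_eq_union {S : Finset P} {x : P} :
    maxElements (S.erase x) =
      (maxElements S).erase x ∪ (maxElements (S.erase x) \ maxElements S) := by
  ext y
  simp only [Finset.mem_union, Finset.mem_erase, Finset.mem_sdiff]
  constructor
  · intro h
    by_cases hy : y ∈ maxElements S
    · exact .inl ⟨Finset.ne_of_mem_erase (maxElements_subset _ h), hy⟩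
    · exact .inr ⟨h, hy⟩
  · rintro (⟨hyx, hy⟩ | h)
    · obtain ⟨h1, h2⟩ := mem_maxElements.1 hy
      exact mem_maxElements.2 ⟨Finset.mem_erase.2 ⟨hyx, h1⟩,
        fun z hz => h2 z (Finset.mem_of_mem_erase hz)⟩
    · exact h.1

/-- The recurrence of Edelman, Hibi and Stanley. For the cut of the maximal elements it is the
recurrence by the top element of a linear extension; an induction on the size of `S` compares an
arbitrary cut with that one, by removing a second element. -/
theorem IsCut.numLE_eq_sum {S A : Finset P} (h : IsCut S A) :
    numLE S = ∑ a ∈ A, numLE (S.erase a) := by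
  induction hn : S.card using Nat.strong_induction_on generalizing S A with
  | _ n ih =>
  subst hn
  have hSne : S.Nonempty := by
    obtain ⟨a, ha, -⟩ := h.extend ∅ (by simp) (by simp)
    exact ⟨a, h.subset ha⟩
  have hcard : ∀ x ∈ S, (S.erase x).card < S.card := fun x hx => Finset.card_erase_lt_of_mem hx
  rw [numLE_eq_sum_maxElements hSne]
  set X := maxElements S with hX
  have hXS : X ⊆ S := maxElements_subset S
  set g : P → P → ℕ := fun a b => numLE ((S.erase a).erase b) with hg
  have hgsymm : ∀ a b, g a b = g b a := fun a b => by simp only [hg, Finset.erase_right_comm]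
  have hsplit : ∀ (U V : Finset P) (f : P → ℕ),
      ∑ x ∈ U \ V, f x + ∑ x ∈ U ∩ V, f x = ∑ x ∈ U, f x := fun U V f => by
    rw [add_comm, Finset.sum_inter_add_sum_sdiff]
  suffices key : ∑ x ∈ X \ A, numLE (S.erase x) = ∑ a ∈ A \ X, numLE (S.erase a) by
    rw [← hsplit X A, ← hsplit A X, key,
      Finset.inter_comm]
  have h1 : ∀ x ∈ X \ A, numLE (S.erase x) = ∑ a ∈ A \ X, g x a + ∑ a ∈ A ∩ X, g x a := by
    intro x hx
    obtain ⟨hxX, hxA⟩ := Finset.mem_sdiff.1 hx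
    rw [hsplit]
    exact ih _ (hcard x (hXS hxX)) (h.erase hxA) rfl
  have h2 : ∀ a ∈ A \ X, numLE (S.erase a) = ∑ x ∈ X \ A, g a x + ∑ x ∈ A ∩ X, g a x := by
    intro a ha
    obtain ⟨haA, haX⟩ := Finset.mem_sdiff.1 ha
    rw [Finset.inter_comm, hsplit, hX,
      ← maxElements_erase_of_notMem (h.subset haA) haX]
    refine numLE_eq_sum_maxElements ?_
    obtain ⟨m, hm, -⟩ := exists_le_maxElements (h.subset haA)
    exact ⟨m, Finset.mem_erase.2 ⟨fun e => haX (e ▸ hm), maxElements_subset _ hm⟩⟩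
  have h3 : ∀ x ∈ A ∩ X, ∑ a ∈ A \ X, g x a = ∑ y ∈ X \ A, g x y := by
    intro x hx
    obtain ⟨hxA, hxX⟩ := Finset.mem_inter.1 hx
    rcases (S.erase x).eq_empty_or_nonempty with he | hne
    · have hS : ∀ y ∈ S, y = x := fun y hy => by
        by_contra hyx
        exact Finset.notMem_empty y (he ▸ Finset.mem_erase.2 ⟨hyx, hy⟩)
      have e1 : A \ X = ∅ := Finset.sdiff_eq_empty_iff_subset.2 fun y hy =>
        hS y (h.subset hy) ▸ hxX
      have e2 : X \ A = ∅ := Finset.sdiff_eq_empty_iff_subset.2 fun y hy => hS y (hXS hy) ▸ hxA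
      rw [e1, e2]
    · set N := maxElements (S.erase x) \ X with hN
      have e1 : numLE (S.erase x) = ∑ a ∈ A.erase x ∪ N, g x a :=
        ih _ (hcard x (hXS hxX)) (h.erase_union hxA hxX hne) rfl
      have e2 : numLE (S.erase x) = ∑ a ∈ X.erase x ∪ N, g x a := by
        rw [numLE_eq_sum_maxElements hne, maxElements_erase_eq_union]
      have d1 : Disjoint (A.erase x) N := by
        refine Finset.disjoint_left.2 fun n hnA hnN => ?_
        obtain ⟨hn1, hn2⟩ := Finset.mem_sdiff.1 hnN
        obtain ⟨m, hm, hnm⟩ := exists_le_maxElements (h.subset (Finset.mem_of_mem_erase hnA))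
        have hlt : n < m := lt_of_le_of_ne hnm fun e => hn2 (e ▸ hm)
        have hmx : m = x := by
          by_contra hmx
          exact (mem_maxElements.1 hn1).2 m
            (Finset.mem_erase.2 ⟨hmx, maxElements_subset _ hm⟩) hlt
        exact Finset.ne_of_mem_erase hnA
          (h.antichain n (Finset.mem_of_mem_erase hnA) x hxA (hmx ▸ hnm))
      have d2 : Disjoint (X.erase x) N :=
        Finset.disjoint_left.2 fun n hn hn' =>
          (Finset.mem_sdiff.1 hn').2 (Finset.mem_of_mem_erase hn)
      rw [e1, Finset.sum_union d1, Finset.sum_union d2, Nat.add_right_cancel_iff,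
        ← hsplit (A.erase x) X, ← hsplit (X.erase x) A] at e2
      have e3 : A.erase x \ X = A \ X := by
        ext y; simp only [Finset.mem_sdiff, Finset.mem_erase]; grind
      have e4 : X.erase x \ A = X \ A := by
        ext y; simp only [Finset.mem_sdiff, Finset.mem_erase]; grind
      have e5 : A.erase x ∩ X = X.erase x ∩ A := by
        ext y; simp only [Finset.mem_inter, Finset.mem_erase]; tauto
      rw [e3, e4, e5] at e2
      exact Nat.add_right_cancel e2
  have h4 : ∑ x ∈ X \ A, ∑ a ∈ A ∩ X, g x a = ∑ x ∈ A \ X, ∑ a ∈ A ∩ X, g x a := by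
    rw [Finset.sum_comm, Finset.sum_comm (s := A \ X)]
    refine Finset.sum_congr rfl fun x hx => ?_
    simp only [hgsymm _ x]
    exact (h3 x hx).symm
  have h5 : ∑ x ∈ X \ A, ∑ a ∈ A \ X, g x a = ∑ a ∈ A \ X, ∑ x ∈ X \ A, g a x := by
    rw [Finset.sum_comm]
    exact Finset.sum_congr rfl fun a _ => Finset.sum_congr rfl fun x _ => hgsymm x a
  rw [Finset.sum_congr rfl h1, Finset.sum_congr rfl h2, Finset.sum_add_distrib,
    Finset.sum_add_distrib, h4, h5]

end Cut

/-! ### The numbers in the formula -/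

/-- The inner sum of the formula over one pivot `i`, where `G i` counts the arrangements of the
elements below the pivot, `c` is the size of the module that contains the pivot, and `T` is the
number of elements of the two following modules. -/
def pivotSum (G : ℕ → ℕ) (T c : ℕ) : ℕ :=
  ∑ i ∈ Finset.range (c + 1), G i * (T + c - i - 1).choose (c - i)

theorem pivotSum_zero_left (G : ℕ → ℕ) (c : ℕ) : pivotSum G 0 c = G c := by
  rw [pivotSum, Finset.sum_range_succ, Finset.sum_eq_zero]
  · simp
  · intro i hi
    rw [Nat.choose_eq_zero_of_lt, mul_zero]
    have := Finset.mem_range.1 hi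
    omega

theorem pivotSum_zero_right (G : ℕ → ℕ) (T : ℕ) : pivotSum G T 0 = G 0 := by
  simp [pivotSum]

theorem pivotSum_succ_succ (G : ℕ → ℕ) (T c : ℕ) :
    pivotSum G (T + 1) (c + 1) = pivotSum G (T + 1) c + pivotSum G T (c + 1) := by
  rw [pivotSum, Finset.sum_range_succ, pivotSum, pivotSum, Finset.sum_range_succ _ (c + 1),
    ← add_assoc (Finset.sum _ _), ← Finset.sum_add_distrib]
  congr 1
  · refine Finset.sum_congr rfl fun i hi => ?_
    have hi := Finset.mem_range.1 hi
    obtain ⟨k, rfl⟩ := Nat.exists_eq_add_of_le (Nat.lt_succ_iff.1 hi)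
    rw [← mul_add, show T + 1 + (i + k + 1) - i - 1 = T + k + 1 by omega,
      show i + k + 1 - i = k + 1 by omega, show T + 1 + (i + k) - i - 1 = T + k by omega,
      show i + k - i = k by omega, show T + (i + k + 1) - i - 1 = T + k by omega,
      Nat.choose_succ_succ]
  · simp

theorem pivotSum_succ_left (G : ℕ → ℕ) (T c : ℕ) :
    pivotSum G (T + 1) c = (if c = 0 then 0 else pivotSum G (T + 1) (c - 1)) + pivotSum G T c := by
  cases c with
  | zero => simp [pivotSum_zero_right]
  | succ c => simpa using pivotSum_succ_succ G T c

open Classical in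
/-- The sum over all pivots `i₁, …, i_{2D-1}`, as a function of the last index `j = i_{2D+1}`, for
modules of sizes `m s`. The proposition `φ (2d)` says that the modules `2d` and `2d + 1` are
joined. -/
noncomputable def shuffleCount (m : ℕ → ℕ) (φ : ℕ → Prop) : ℕ → ℕ → ℕ
  | 0, _ => 1
  | D + 1, j => pivotSum (shuffleCount m φ D) (m (2 * D + 2) + j) (m (2 * D + 1)) *
      if φ (2 * D + 2) then (m (2 * D + 2) + j).choose (m (2 * D + 2)) else 1

theorem shuffleCount_congr {m m' : ℕ → ℕ} {φ : ℕ → Prop} {D : ℕ}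
    (h : ∀ s ∈ Finset.Icc 1 (2 * D), m s = m' s) (j : ℕ) :
    shuffleCount m φ D j = shuffleCount m' φ D j := by
  induction D generalizing j with
  | zero => rfl
  | succ D ih =>
    have hD : shuffleCount m φ D = shuffleCount m' φ D :=
      funext fun j => ih (fun s hs => h s (by simp only [Finset.mem_Icc] at hs ⊢; omega)) j
    rw [shuffleCount, shuffleCount, hD, h (2 * D + 2) (by simp only [Finset.mem_Icc]; omega),
      h (2 * D + 1) (by simp only [Finset.mem_Icc]; omega)]

/-- The value of `W` after one element has been removed from module number `s`, and zero if there is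
no such element. -/
def removeOne (W : (ℕ → ℕ) → ℕ) (m : ℕ → ℕ) (s : ℕ) : ℕ :=
  if m s = 0 then 0 else W (Function.update m s (m s - 1))

section
variable (m : ℕ → ℕ) (φ : ℕ → Prop) (D : ℕ)

theorem shuffleCount_drop (h2 : m (2 * D + 2) = 0) (h3 : m (2 * D + 3) = 0) :
    shuffleCount m φ (D + 1) (m (2 * D + 3)) = shuffleCount m φ D (m (2 * D + 1)) := by
  simp [shuffleCount, h2, h3, pivotSum_zero_left]

theorem shuffleCount_update {s v : ℕ} (hs : 2 * D < s) :
    shuffleCount (Function.update m s v) φ D = shuffleCount m φ D :=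
  funext <| shuffleCount_congr fun t ht => Function.update_of_ne
    (by simp only [Finset.mem_Icc] at ht; omega) _ _

/-- If the modules `2D + 2` and `2D + 3` are joined, then an element of either of them, or of module
`2D + 1`, can be removed first. -/
theorem shuffleCount_of_joined (hφ : φ (2 * D + 2)) (hT : m (2 * D + 2) + m (2 * D + 3) ≠ 0) :
    shuffleCount m φ (D + 1) (m (2 * D + 3)) =
      ∑ s ∈ {2 * D + 1, 2 * D + 2, 2 * D + 3},
        removeOne (fun m => shuffleCount m φ (D + 1) (m (2 * D + 3))) m s := by
  rw [Finset.sum_insert (by simp), Finset.sum_insert (by simp), Finset.sum_singleton]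
  simp only [removeOne, shuffleCount, hφ, if_true]
  rw [shuffleCount_update m φ D (by omega), shuffleCount_update m φ D (by omega),
    shuffleCount_update m φ D (by omega)]
  simp only [Function.update_self, Function.update_of_ne, ne_eq, Nat.reduceEqDiff,
    not_false_eq_true, add_right_inj, Nat.reduceEqDiff]
  generalize shuffleCount m φ D = G
  generalize m (2 * D + 1) = c at *
  generalize m (2 * D + 2) = a at *
  generalize m (2 * D + 3) = j at *
  obtain ⟨T, hT'⟩ := Nat.exists_eq_succ_of_ne_zero hT
  rw [hT', Nat.succ_eq_add_one, pivotSum_succ_left, add_mul, ite_mul, zero_mul]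
  congr 1
  rcases a with _ | a
  · rcases j with _ | j
    · omega
    · have : T = j := by omega
      simp [this]
  · rcases j with _ | j
    · have : T = a := by omega
      simp [this]
    · have : T = a + j + 1 := by omega
      subst this
      simp only [Nat.add_eq_zero_iff, one_ne_zero, and_false, if_false, Nat.add_sub_cancel]
      rw [show a + (j + 1) = a + j + 1 by omega, show a + 1 + j = a + j + 1 by omega,
        Nat.choose_succ_succ, mul_add]

/-- If the modules `2D + 2` and `2D + 3` are not joined, then it is enough to remove elements of
module `2D + 1` and of one non-empty module out of these two. -/
theorem shuffleCount_of_not_joined (hφ : ¬ φ (2 * D + 2)) {u : ℕ}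
    (hu : u = 2 * D + 2 ∨ u = 2 * D + 3) (hmu : m u ≠ 0) :
    shuffleCount m φ (D + 1) (m (2 * D + 3)) =
      ∑ s ∈ {2 * D + 1, u},
        removeOne (fun m => shuffleCount m φ (D + 1) (m (2 * D + 3))) m s := by
  rw [Finset.sum_insert (by simp; omega), Finset.sum_singleton]
  simp only [removeOne, shuffleCount, hφ, if_false, mul_one, hmu]
  rw [shuffleCount_update m φ D (by omega), shuffleCount_update m φ D (by omega)]
  simp only [Function.update_self, Function.update_of_ne, ne_eq, Nat.reduceEqDiff,
    not_false_eq_true, add_right_inj, Nat.reduceEqDiff]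
  generalize shuffleCount m φ D = G
  obtain ⟨v, hv⟩ := Nat.exists_eq_succ_of_ne_zero hmu
  rcases hu with rfl | rfl
  · simp only [Function.update_self, Function.update_of_ne, ne_eq, Nat.reduceEqDiff,
      not_false_eq_true, add_right_inj, hv, Nat.succ_eq_add_one, Nat.add_sub_cancel]
    rw [show v + 1 + m (2 * D + 3) = v + m (2 * D + 3) + 1 by omega, pivotSum_succ_left]
  · simp only [Function.update_self, Function.update_of_ne, ne_eq, Nat.reduceEqDiff,
      not_false_eq_true, add_right_inj, hv, Nat.succ_eq_add_one, Nat.add_sub_cancel]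
    rw [← add_assoc, pivotSum_succ_left]

end

/-! ### Cuts adapted to a family of modules -/

section Parts
variable {P : Type*}

open Classical in
/-- The part of `S` in the module number `s`. -/
noncomputable def part (M : ℕ → Set P) (S : Finset P) (s : ℕ) : Finset P := {x ∈ S | x ∈ M s}

theorem mem_part {M : ℕ → Set P} {S : Finset P} {s : ℕ} {x : P} :
    x ∈ part M S s ↔ x ∈ S ∧ x ∈ M s := by
  simp [part]

theorem part_erase_self [DecidableEq P] {M : ℕ → Set P} {S : Finset P} {s : ℕ} {x : P} :
    part M (S.erase x) s = (part M S s).erase x := by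
  ext y
  simp only [mem_part, Finset.mem_erase]
  tauto

variable [PartialOrder P]

/-- Disjoint sets `M s`, for `s ∈ L`, such that the comparability of elements in different sets is
described by a graph on the indices. -/
structure IsJoinedFamily (M : ℕ → Set P) (K : SimpleGraph ℕ) (L : Finset ℕ) : Prop where
  disjoint : ∀ s ∈ L, ∀ t ∈ L, s ≠ t → Disjoint (M s) (M t)
  incomp : ∀ s ∈ L, ∀ t ∈ L, K.Adj s t → ∀ x ∈ M s, ∀ y ∈ M t, IncompRel (· ≤ ·) x y
  comp : ∀ s ∈ L, ∀ t ∈ L, s ≠ t → ¬ K.Adj s t → ∀ x ∈ M s, ∀ y ∈ M t, x ≤ y ∨ y ≤ x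

theorem IsJoinedFamily.mono {M : ℕ → Set P} {K : SimpleGraph ℕ} {L L' : Finset ℕ}
    (h : IsJoinedFamily M K L) (hL : L' ⊆ L) : IsJoinedFamily M K L' where
  disjoint s hs t ht := h.disjoint s (hL hs) t (hL ht)
  incomp s hs t ht := h.incomp s (hL hs) t (hL ht)
  comp s hs t ht := h.comp s (hL hs) t (hL ht)

variable [DecidableEq P] {M : ℕ → Set P} {K : SimpleGraph ℕ} {L : Finset ℕ}

theorem part_erase_of_ne (h : IsJoinedFamily M K L) {S : Finset P} {s t : ℕ} (hs : s ∈ L)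
    (ht : t ∈ L) (hst : t ≠ s) {x : P} (hx : x ∈ M s) :
    part M (S.erase x) t = part M S t := by
  ext y
  simp only [mem_part, Finset.mem_erase]
  refine ⟨fun hy => ⟨hy.1.2, hy.2⟩, fun hy => ⟨⟨?_, hy.1⟩, hy.2⟩⟩
  rintro rfl
  exact Set.disjoint_left.1 (h.disjoint t ht s hs hst) hy.2 hx

/-- The maximal elements of the parts with indices in `I` form a cut if these parts are pairwise
joined, and if for every set `J` of pairwise unjoined parts there is an index in `I` that is not
joined to an index in `J`. -/
theorem isCut_biUnion_maxElements (h : IsJoinedFamily M K L) {S : Finset P}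
    (hS : ∀ x ∈ S, ∃ s ∈ L, x ∈ M s) {I : Finset ℕ} (hI : I ⊆ L)
    (hadj : ∀ s ∈ I, ∀ t ∈ I, s ≠ t → (part M S s).Nonempty → (part M S t).Nonempty → K.Adj s t)
    (hJ : ∀ J ⊆ L, (∀ s ∈ J, (part M S s).Nonempty) → (∀ s ∈ J, ∀ t ∈ J, ¬ K.Adj s t) →
      ∃ s ∈ I, (part M S s).Nonempty ∧ ∀ t ∈ J, ¬ K.Adj s t) :
    IsCut S (I.biUnion fun s => maxElements (part M S s)) := by
  classical
  have hmem : ∀ {s x}, x ∈ maxElements (part M S s) → x ∈ S ∧ x ∈ M s := fun hx =>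
    mem_part.1 (maxElements_subset _ hx)
  constructor
  · intro x hx
    obtain ⟨s, -, hx⟩ := Finset.mem_biUnion.1 hx
    exact (hmem hx).1
  · intro a ha b hb hab
    obtain ⟨s, hs, ha⟩ := Finset.mem_biUnion.1 ha
    obtain ⟨t, ht, hb⟩ := Finset.mem_biUnion.1 hb
    by_cases hst : s = t
    · subst hst
      by_contra hne
      exact (mem_maxElements.1 ha).2 b (maxElements_subset _ hb) (lt_of_le_of_ne hab hne)
    · exact absurd hab (h.incomp s (hI hs) t (hI ht)
        (hadj s hs t ht hst ⟨a, maxElements_subset _ ha⟩ ⟨b, maxElements_subset _ hb⟩)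
        a (hmem ha).2 b (hmem hb).2).1
  · intro C hCS hC
    obtain ⟨s, hs, hne, hsJ⟩ := hJ {t ∈ L | (part M C t).Nonempty} (Finset.filter_subset _ _)
      (fun t ht => by
        obtain ⟨x, hx⟩ := (Finset.mem_filter.1 ht).2
        exact ⟨x, mem_part.2 ⟨hCS (mem_part.1 hx).1, (mem_part.1 hx).2⟩⟩)
      (fun t ht u hu htu => by
        obtain ⟨ht, x, hx⟩ := Finset.mem_filter.1 ht
        obtain ⟨hu, y, hy⟩ := Finset.mem_filter.1 hu
        have hinc := h.incomp t ht u hu htu x (mem_part.1 hx).2 y (mem_part.1 hy).2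
        exact (hC.total (mem_part.1 hx).1 (mem_part.1 hy).1).elim hinc.1 hinc.2)
    have hsub : part M C s ⊆ part M S s := fun x hx =>
      mem_part.2 ⟨hCS (mem_part.1 hx).1, (mem_part.1 hx).2⟩
    obtain ⟨a, ha, hle⟩ := exists_maxElements_of_isChain hne hsub
      (hC.mono fun x hx => (mem_part.1 hx).1)
    refine ⟨a, Finset.mem_biUnion.2 ⟨s, hs, ha⟩, fun c hc => ?_⟩
    obtain ⟨t, ht, hct⟩ := hS c (hCS hc)
    by_cases hst : s = t
    · subst hst
      exact .inr (hle c (mem_part.2 ⟨hc, hct⟩))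
    · exact h.comp s (hI hs) t ht hst
        (hsJ t (Finset.mem_filter.2 ⟨ht, c, mem_part.2 ⟨hc, hct⟩⟩)) a (hmem ha).2 c hct

/-- The contribution of the part number `s` to the recurrence along a cut. -/
theorem sum_maxElements_part (h : IsJoinedFamily M K L) {S : Finset P} {W : (ℕ → ℕ) → ℕ}
    (hW : ∀ m m' : ℕ → ℕ, (∀ t ∈ L, m t = m' t) → W m = W m') {s : ℕ} (hs : s ∈ L)
    (ih : ∀ x ∈ S, numLE (S.erase x) =
      (∏ t ∈ L, numLE (part M (S.erase x) t)) * W fun t => (part M (S.erase x) t).card) :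
    ∑ x ∈ maxElements (part M S s), numLE (S.erase x) =
      (∏ t ∈ L, numLE (part M S t)) * removeOne W (fun t => (part M S t).card) s := by
  rcases (part M S s).eq_empty_or_nonempty with he | hne
  · have : maxElements (part M S s) = ∅ :=
      Finset.subset_empty.1 (he ▸ maxElements_subset (part M S s))
    rw [this, Finset.sum_empty]
    simp [removeOne, he]
  · have hcard : (part M S s).card ≠ 0 := Finset.card_ne_zero.2 hne
    rw [removeOne, if_neg hcard, ← Finset.mul_prod_erase L _ hs, numLE_eq_sum_maxElements hne,
      Finset.sum_mul, Finset.sum_mul]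
    refine Finset.sum_congr rfl fun x hx => ?_
    have hxs := maxElements_subset _ hx
    obtain ⟨hxS, hxM⟩ := mem_part.1 hxs
    rw [ih x hxS, ← Finset.mul_prod_erase L _ hs, part_erase_self]
    congr 1
    · congr 1
      refine Finset.prod_congr rfl fun t ht => ?_
      rw [part_erase_of_ne h hs (Finset.mem_of_mem_erase ht) (Finset.ne_of_mem_erase ht) hxM]
    · refine hW _ _ fun t ht => ?_
      by_cases hts : t = s
      · subst hts
        rw [Function.update_self, part_erase_self, Finset.card_erase_of_mem hxs]
      · rw [Function.update_of_ne hts, part_erase_of_ne h hs ht hts hxM]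

theorem numLE_eq_sum_removeOne (h : IsJoinedFamily M K L) {S : Finset P} {W : (ℕ → ℕ) → ℕ}
    (hW : ∀ m m' : ℕ → ℕ, (∀ t ∈ L, m t = m' t) → W m = W m')
    (ih : ∀ x ∈ S, numLE (S.erase x) =
      (∏ t ∈ L, numLE (part M (S.erase x) t)) * W fun t => (part M (S.erase x) t).card)
    {I : Finset ℕ} (hI : I ⊆ L)
    (hcut : IsCut S (I.biUnion fun s => maxElements (part M S s))) :
    numLE S = (∏ t ∈ L, numLE (part M S t)) *
      ∑ s ∈ I, removeOne W (fun t => (part M S t).card) s := by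
  rw [hcut.numLE_eq_sum, Finset.sum_biUnion, Finset.mul_sum]
  · exact Finset.sum_congr rfl fun s hs => sum_maxElements_part h hW (hI hs) ih
  · intro s hs t ht hst
    refine Finset.disjoint_left.2 fun x hx hy => ?_
    exact Set.disjoint_left.1 (h.disjoint s (hI hs) t (hI ht) hst)
      (mem_part.1 (maxElements_subset _ hx)).2 (mem_part.1 (maxElements_subset _ hy)).2

end Parts

/-! ### Posets with a joined skeleton -/

section Joined
variable {P : Type*} [PartialOrder P] [DecidableEq P]

/-- The formula for all subsets of the modules `1, …, 2D+1`, by induction on the size of the subset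
and then on `D`. -/
theorem numLE_eq_prod_mul_shuffleCount {M : ℕ → Set P} {K : SimpleGraph ℕ} {D : ℕ}
    (h : IsJoinedFamily M K (Finset.Icc 1 (2 * D + 1))) (hK : IsJoinedSkeleton D M K)
    {S : Finset P} (hS : ∀ x ∈ S, ∃ s ∈ Finset.Icc 1 (2 * D + 1), x ∈ M s) :
    numLE S = (∏ s ∈ Finset.Icc 1 (2 * D + 1), numLE (part M S s)) *
      shuffleCount (fun s => (part M S s).card) (fun s => K.Adj s (s + 1)) D
        (part M S (2 * D + 1)).card := by
  induction hn : S.card using Nat.strong_induction_on generalizing S D with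
  | _ n ihn =>
  induction D with
  | zero =>
    have : part M S 1 = S := Finset.Subset.antisymm (fun x hx => (mem_part.1 hx).1) fun x hx => by
      obtain ⟨s, hs, hx'⟩ := hS x hx
      have : s = 1 := by simpa using hs
      exact mem_part.2 ⟨hx, this ▸ hx'⟩
    simp [shuffleCount, this]
  | succ D ihD =>
    set L := Finset.Icc 1 (2 * (D + 1) + 1) with hL
    have hmemL : ∀ {s}, s ∈ L ↔ 1 ≤ s ∧ s ≤ 2 * D + 3 := by
      intro s; rw [hL, Finset.mem_Icc]; omega
    set m : ℕ → ℕ := fun s => (part M S s).card with hm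
    set φ : ℕ → Prop := fun s => K.Adj s (s + 1) with hφ
    have hne : ∀ s, (part M S s).Nonempty ↔ m s ≠ 0 := fun s => Finset.card_ne_zero.symm
    by_cases hT : m (2 * D + 2) = 0 ∧ m (2 * D + 3) = 0
    · -- the two last parts are empty
      obtain ⟨h2, h3⟩ := hT
      have hsub : Finset.Icc 1 (2 * D + 1) ⊆ L := fun s hs => by
        rw [Finset.mem_Icc] at hs; rw [hmemL]; omega
      have hlast := shuffleCount_drop m φ D h2 h3
      have hprod : ∏ s ∈ L, numLE (part M S s) =
          ∏ s ∈ Finset.Icc 1 (2 * D + 1), numLE (part M S s) := by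
        symm
        refine Finset.prod_subset hsub fun s hs hs' => ?_
        rw [hmemL] at hs
        rw [Finset.mem_Icc] at hs'
        have : s = 2 * D + 2 ∨ s = 2 * D + 3 := by omega
        have he : part M S s = ∅ := by
          rcases this with rfl | rfl
          · exact Finset.card_eq_zero.1 h2
          · exact Finset.card_eq_zero.1 h3
        rw [he, numLE_empty]
      rw [hprod]
      refine (ihD (h.mono hsub) ⟨fun k h1 h2 => hK.odd_odd k h1 (by omega),
        fun k h1 h2 => hK.odd_even k h1 (by omega), fun s t hs hst ht hadj => ?_⟩ ?_).trans ?_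
      · obtain ⟨k, hk, -, hk'⟩ := hK.no_other s t hs hst (by omega) hadj
        exact ⟨k, hk, by omega, hk'⟩
      · intro x hx
        obtain ⟨s, hs, hxs⟩ := hS x hx
        refine ⟨s, ?_, hxs⟩
        have hms : m s ≠ 0 := (hne s).1 ⟨x, mem_part.2 ⟨hx, hxs⟩⟩
        have h2' : s ≠ 2 * D + 2 := fun e => hms (e ▸ h2)
        have h3' : s ≠ 2 * D + 3 := fun e => hms (e ▸ h3)
        rw [hmemL] at hs
        rw [Finset.mem_Icc]
        omega
      · exact congrArg _ hlast.symm
    · -- the edges of the skeleton between the last three modules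
      have e13 : K.Adj (2 * D + 1) (2 * D + 3) := hK.odd_odd (D + 1) (by omega) le_rfl
      have e12 : m (2 * D + 2) ≠ 0 → K.Adj (2 * D + 1) (2 * D + 2) := fun h0 => by
        obtain ⟨x, hx⟩ := (hne _).2 h0
        exact hK.odd_even (D + 1) (by omega) le_rfl ⟨x, (mem_part.1 hx).2⟩
      have hnb3 : ∀ t ∈ L, K.Adj (2 * D + 3) t → t = 2 * D + 1 ∨ t = 2 * D + 2 := by
        intro t ht hadj
        have := hadj.ne
        rw [hmemL] at ht
        obtain ⟨k, hk, hk', hk''⟩ := hK.no_other t (2 * D + 3) ht.1 (by omega) (by omega) hadj.symm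
        omega
      have hnb2 : ∀ t ∈ L, K.Adj (2 * D + 2) t → t = 2 * D + 1 ∨ t = 2 * D + 3 := by
        intro t ht hadj
        have := hadj.ne
        rw [hmemL] at ht
        by_cases h3 : t = 2 * D + 3
        · exact .inr h3
        obtain ⟨k, hk, hk', hk''⟩ := hK.no_other t (2 * D + 2) ht.1 (by omega) (by omega) hadj.symm
        omega
      have hW : ∀ m m' : ℕ → ℕ, (∀ t ∈ L, m t = m' t) →
          shuffleCount m φ (D + 1) (m (2 * D + 3)) =
            shuffleCount m' φ (D + 1) (m' (2 * D + 3)) := by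
        intro m m' hmm
        rw [hmm (2 * D + 3) (hmemL.2 (by omega))]
        refine shuffleCount_congr (fun s hs => hmm s (hmemL.2 ?_)) _
        rw [Finset.mem_Icc] at hs
        omega
      have ih : ∀ x ∈ S, numLE (S.erase x) = (∏ t ∈ L, numLE (part M (S.erase x) t)) *
          (fun m : ℕ → ℕ => shuffleCount m φ (D + 1) (m (2 * D + 3)))
            fun t => (part M (S.erase x) t).card := fun x hx =>
        ihn _ (hn ▸ Finset.card_erase_lt_of_mem hx) h hK
          (fun y hy => hS y (Finset.mem_of_mem_erase hy)) rfl
      by_cases hj : φ (2 * D + 2)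
      · have hI : ({2 * D + 1, 2 * D + 2, 2 * D + 3} : Finset ℕ) ⊆ L := fun s hs => by
          simp only [Finset.mem_insert, Finset.mem_singleton] at hs
          rw [hmemL]; omega
        have hcut := isCut_biUnion_maxElements h hS hI ?_ ?_
        · rw [numLE_eq_sum_removeOne h hW ih hI hcut]
          congr 1
          exact (shuffleCount_of_joined m φ D hj (by omega)).symm
        · intro s hs t ht hst hs0 ht0
          simp only [Finset.mem_insert, Finset.mem_singleton] at hs ht
          rw [hne] at hs0 ht0
          rcases hs with rfl | rfl | rfl <;> rcases ht with rfl | rfl | rfl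
          · exact absurd rfl hst
          · exact e12 ht0
          · exact e13
          · exact (e12 hs0).symm
          · exact absurd rfl hst
          · exact hj
          · exact e13.symm
          · exact hj.symm
          · exact absurd rfl hst
        · intro J hJL hJ0 hJ
          by_cases hex : ∃ s ∈ J, s ∈ ({2 * D + 1, 2 * D + 2, 2 * D + 3} : Finset ℕ)
          · obtain ⟨s, hsJ, hsI⟩ := hex
            exact ⟨s, hsI, hJ0 s hsJ, hJ s hsJ⟩
          · have hJI : ∀ s ∈ J, s ≠ 2 * D + 1 ∧ s ≠ 2 * D + 2 ∧ s ≠ 2 * D + 3 := by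
              intro s hs
              by_contra hc
              refine hex ⟨s, hs, ?_⟩
              simp only [Finset.mem_insert, Finset.mem_singleton]
              omega
            by_cases h2 : m (2 * D + 2) = 0
            · refine ⟨2 * D + 3, by simp, (hne _).2 (by omega), fun t ht hadj => ?_⟩
              have := hnb3 t (hJL ht) hadj
              have := hJI t ht
              omega
            · refine ⟨2 * D + 2, by simp, (hne _).2 h2, fun t ht hadj => ?_⟩
              have := hnb2 t (hJL ht) hadj
              have := hJI t ht
              omega
      · obtain ⟨u, hu, hmu⟩ : ∃ u, (u = 2 * D + 2 ∨ u = 2 * D + 3) ∧ m u ≠ 0 := by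
          by_cases h2 : m (2 * D + 2) = 0
          · exact ⟨2 * D + 3, .inr rfl, by omega⟩
          · exact ⟨2 * D + 2, .inl rfl, h2⟩
        have e1u : K.Adj (2 * D + 1) u := by
          rcases hu with rfl | rfl
          · exact e12 hmu
          · exact e13
        have hI : ({2 * D + 1, u} : Finset ℕ) ⊆ L := fun s hs => by
          simp only [Finset.mem_insert, Finset.mem_singleton] at hs
          rw [hmemL]; omega
        have hcut := isCut_biUnion_maxElements h hS hI ?_ ?_
        · rw [numLE_eq_sum_removeOne h hW ih hI hcut]
          congr 1
          exact (shuffleCount_of_not_joined m φ D hj hu hmu).symm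
        · intro s hs t ht hst _ _
          simp only [Finset.mem_insert, Finset.mem_singleton] at hs ht
          rcases hs with rfl | rfl <;> rcases ht with rfl | rfl
          · exact absurd rfl hst
          · exact e1u
          · exact e1u.symm
          · exact absurd rfl hst
        · intro J hJL hJ0 hJ
          by_cases h1 : 2 * D + 1 ∈ J
          · exact ⟨2 * D + 1, by simp, hJ0 _ h1, hJ _ h1⟩
          · refine ⟨u, by simp, (hne _).2 hmu, fun t ht hadj => ?_⟩
            have h1t : t ≠ 2 * D + 1 := fun e => h1 (e ▸ ht)
            rcases hu with rfl | rfl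
            · rcases hnb2 t (hJL ht) hadj with rfl | rfl
              · exact h1t rfl
              · exact hj hadj
            · rcases hnb3 t (hJL ht) hadj with rfl | rfl
              · exact h1t rfl
              · exact hj hadj.symm

end Joined

/-! ### The sum over pivot tuples -/

/-- The tuples of possible pivots whose last entry is `j`. -/
def pivotTuplesOf (D : ℕ) (m : ℕ → ℕ) (j : ℕ) : Finset (Fin (D + 1) → ℕ) :=
  Fintype.piFinset fun k =>
    if (k : ℕ) = D then {j} else Finset.range (m (2 * (k : ℕ) + 1) + 1)

theorem mem_pivotTuplesOf {D : ℕ} {m : ℕ → ℕ} {j : ℕ} {i : Fin (D + 1) → ℕ} :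
    i ∈ pivotTuplesOf D m j ↔ i (Fin.last D) = j ∧
      ∀ k : Fin D, i k.castSucc ≤ m (2 * (k : ℕ) + 1) := by
  rw [pivotTuplesOf, Fintype.mem_piFinset, Fin.forall_fin_succ', and_comm]
  simp [Fin.val_last, (Fin.is_lt _).ne]

/-- Splitting off the last entry but one of a pivot tuple. -/
theorem sum_pivotTuplesOf_succ (D : ℕ) (m : ℕ → ℕ) (j : ℕ) (f : (Fin (D + 2) → ℕ) → ℕ) :
    ∑ i ∈ pivotTuplesOf (D + 1) m j, f i =
      ∑ l ∈ Finset.range (m (2 * D + 1) + 1), ∑ i ∈ pivotTuplesOf D m l,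
        f (Fin.snoc (α := fun _ => ℕ) i j) := by
  rw [Finset.sum_sigma']
  refine Finset.sum_bij' (fun i _ => ⟨i (Fin.last D).castSucc, Fin.init i⟩)
    (fun p _ => Fin.snoc (α := fun _ => ℕ) p.2 j) ?_ ?_ ?_ ?_ ?_
  · intro i hi
    obtain ⟨-, h2⟩ := mem_pivotTuplesOf.1 hi
    refine Finset.mem_sigma.2 ⟨?_, mem_pivotTuplesOf.2 ⟨rfl, fun k => h2 k.castSucc⟩⟩
    rw [Finset.mem_range, Nat.lt_succ_iff]
    exact h2 (Fin.last D)
  · rintro ⟨l, i⟩ hp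
    obtain ⟨hl, hi⟩ := Finset.mem_sigma.1 hp
    obtain ⟨h1, h2⟩ := mem_pivotTuplesOf.1 hi
    rw [Finset.mem_range, Nat.lt_succ_iff] at hl
    refine mem_pivotTuplesOf.2 ⟨Fin.snoc_last _ _, fun k => ?_⟩
    rw [Fin.snoc_castSucc]
    refine Fin.lastCases ?_ (fun k => ?_) k
    · exact (le_of_eq h1).trans hl
    · exact h2 k
  · intro i hi
    obtain ⟨h1, -⟩ := mem_pivotTuplesOf.1 hi
    simp only
    rw [← h1]
    exact Fin.snoc_init_self i
  · rintro ⟨l, i⟩ hp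
    obtain ⟨-, hi⟩ := Finset.mem_sigma.1 hp
    obtain ⟨h1, -⟩ := mem_pivotTuplesOf.1 hi
    have e1 : (Fin.snoc (α := fun _ => ℕ) i j : Fin (D + 2) → ℕ) (Fin.last D).castSucc = l := by
      rw [Fin.snoc_castSucc]; exact h1
    have e2 : Fin.init (α := fun _ => ℕ) (Fin.snoc (α := fun _ => ℕ) i j) = i := Fin.init_snoc _ _
    exact Sigma.ext e1 (heq_of_eq e2)
  · intro i hi
    obtain ⟨h1, -⟩ := mem_pivotTuplesOf.1 hi
    rw [← h1]
    exact congrArg f (Fin.snoc_init_self i).symm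

open Classical in
theorem shuffleCount_eq_sum (m : ℕ → ℕ) (φ : ℕ → Prop) (D j : ℕ) :
    shuffleCount m φ D j = ∑ i ∈ pivotTuplesOf D m j, ∏ d : Fin D,
      ((m (2 * (d : ℕ) + 2) + m (2 * (d : ℕ) + 1) + i d.succ - i d.castSucc - 1).choose
          (m (2 * (d : ℕ) + 1) - i d.castSucc) *
        if φ (2 * (d : ℕ) + 2) then
          (m (2 * (d : ℕ) + 2) + i d.succ).choose (m (2 * (d : ℕ) + 2)) else 1) := by
  induction D generalizing j with
  | zero =>
    have : pivotTuplesOf 0 m j = {fun _ => j} := by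
      ext i
      rw [mem_pivotTuplesOf, Finset.mem_singleton]
      refine ⟨fun h => funext fun k => ?_, fun h => ⟨by rw [h], fun k => k.elim0⟩⟩
      rw [show k = Fin.last 0 from Fin.eq_zero k, h.1]
    simp [shuffleCount, this]
  | succ D ih =>
    rw [sum_pivotTuplesOf_succ, shuffleCount, pivotSum, Finset.sum_mul]
    refine Finset.sum_congr rfl fun l _ => ?_
    rw [ih, Finset.sum_mul, Finset.sum_mul]
    refine Finset.sum_congr rfl fun i hi => ?_
    obtain ⟨h1, -⟩ := mem_pivotTuplesOf.1 hi
    rw [Fin.prod_univ_castSucc, mul_assoc]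
    congr 1
    · refine Finset.prod_congr rfl fun d _ => ?_
      rw [← Fin.castSucc_succ, Fin.snoc_castSucc, Fin.snoc_castSucc, Fin.val_castSucc]
    · rw [Fin.succ_last, Fin.snoc_last, Fin.snoc_castSucc, h1, Fin.val_last,
        show m (2 * D + 2) + m (2 * D + 1) + j = m (2 * D + 2) + j + m (2 * D + 1) by omega]

/-! ### Modular partitions -/

theorem IsGraphModule.adj_iff {V : Type*} {G : SimpleGraph V} {A B : Set V}
    (hA : IsGraphModule G A) (hB : IsGraphModule G B) (hAB : Disjoint A B) {x x' y y' : V}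
    (hx : x ∈ A) (hx' : x' ∈ A) (hy : y ∈ B) (hy' : y' ∈ B) : G.Adj x y ↔ G.Adj x' y' := by
  rw [hA.2 x hx x' hx' y (Set.disjoint_right.1 hAB hy), G.adj_comm, G.adj_comm x',
    hB.2 y hy y' hy' x' (Set.disjoint_left.1 hAB hx')]

theorem IsModularPartition.isJoinedFamily {P : Type*} [PartialOrder P] {D : ℕ} {M : ℕ → Set P}
    (hM : IsModularPartition (incomparabilityGraph P) (moduleIndices D M) M) :
    IsJoinedFamily M (skeletonGraph (incomparabilityGraph P) M) (Finset.Icc 1 (2 * D + 1)) := by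
  have hmem : ∀ s ∈ Finset.Icc 1 (2 * D + 1), ∀ x ∈ M s, s ∈ moduleIndices D M :=
    fun s hs x hx => ⟨(Finset.mem_Icc.1 hs).1, (Finset.mem_Icc.1 hs).2, .inr ⟨x, hx⟩⟩
  have hdisj : ∀ s ∈ Finset.Icc 1 (2 * D + 1), ∀ t ∈ Finset.Icc 1 (2 * D + 1), s ≠ t →
      Disjoint (M s) (M t) := fun s hs t ht hst => Set.disjoint_left.2 fun x hx hx' =>
    Set.disjoint_left.1 (hM.disjoint s (hmem s hs x hx) t (hmem t ht x hx') hst) hx hx'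
  refine ⟨hdisj, fun s hs t ht hadj x hx y hy => ?_, fun s hs t ht hst hadj x hx y hy => ?_⟩
  · obtain ⟨hst, x', hx', y', hy', h⟩ := hadj
    exact ((hM.isModule s (hmem s hs x hx)).adj_iff (hM.isModule t (hmem t ht y hy))
      (hdisj s hs t ht hst) hx' hx hy' hy).1 h
  · by_contra hc
    exact hadj ⟨hst, x, hx, y, hy, fun h => hc (.inl h), fun h => hc (.inr h)⟩

theorem pivotFactor_eq {P : Type*} [PartialOrder P] {M : ℕ → Set P} {K : SimpleGraph ℕ}
    {L : Finset ℕ} (h : IsJoinedFamily M K L) {s : ℕ} (hs : s ∈ L) (hs' : s + 1 ∈ L)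
    (hne : (M (s + 1)).Nonempty) [Decidable (K.Adj s (s + 1))] (j : ℕ) :
    pivotFactor (M s) (M (s + 1)) j =
      if K.Adj s (s + 1) then ((M s).ncard + j).choose (M s).ncard else 1 := by
  classical
  rw [pivotFactor]
  rcases (M s).eq_empty_or_nonempty with he | hn
  · simp [he]
  · refine if_congr ⟨fun ⟨_, hall⟩ => ?_, fun hadj => ⟨hn, h.incomp s hs _ hs' hadj⟩⟩ rfl rfl
    obtain ⟨x, hx⟩ := hn
    obtain ⟨y, hy⟩ := hne
    by_contra hadj
    exact (h.comp s hs _ hs' (by omega) hadj x hx y hy).elim (hall x hx y hy).1 (hall x hx y hy).2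

theorem theorem4p4 {P : Type*} [Finite P] [PartialOrder P] (D : ℕ) (M : ℕ → Set P)
    (hM : IsModularPartition (incomparabilityGraph P) (moduleIndices D M) M)
    (hS : IsJoinedSkeleton D M (skeletonGraph (incomparabilityGraph P) M)) :
    numLinearExtensions P =
      (∏ s ∈ Finset.Icc 1 (2 * D + 1), numLinearExtensions (M s)) *
        ∑ i ∈ pivotTuples D (fun k => (M k).ncard), pivotTerm D M i := by
  classical
  have := Fintype.ofFinite P
  have hfam := hM.isJoinedFamily
  have hpart : ∀ s (x : P), x ∈ part M Finset.univ s ↔ x ∈ M s := fun s x => by simp [mem_part]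
  have hcard : ∀ s, (part M Finset.univ s).card = (M s).ncard := fun s => by
    rw [← Set.ncard_coe_finset]
    exact congrArg Set.ncard (Set.ext fun x => hpart s x)
  have huniv : numLinearExtensions P = numLE (Finset.univ : Finset P) :=
    numLinearExtensions_congr ⟨(Equiv.subtypeUnivEquiv Finset.mem_univ).symm, Iff.rfl⟩
  have hmod : ∀ s, numLE (part M Finset.univ s) = numLinearExtensions (M s) := fun s =>
    numLinearExtensions_congr ⟨Equiv.subtypeEquivRight (hpart s), Iff.rfl⟩
  rw [huniv, numLE_eq_prod_mul_shuffleCount hfam hS fun x _ => by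
    obtain ⟨s, hs, hx⟩ := hM.cover x
    exact ⟨s, Finset.mem_Icc.2 ⟨hs.1, hs.2.1⟩, hx⟩]
  simp only [hcard, hmod]
  rw [shuffleCount_eq_sum]
  congr 1
  refine Finset.sum_congr rfl fun i _ => Finset.prod_congr rfl fun d _ => ?_
  have hd := d.2
  rw [pivotFactor_eq hfam (by rw [Finset.mem_Icc]; omega) (by rw [Finset.mem_Icc]; omega)
    (hM.isModule _ ⟨by omega, by omega, .inl ⟨(d : ℕ) + 1, by omega⟩⟩).1]
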